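/- All graphs are finite and simple. For a graph $G$ and a vertex $v$, the link of $v$ is the subgraph of $G$ induced by the open neighborhood $N_G(v)$; $G$ has constant link $L$ if the link of every vertex of $G$ is isomorphic to $L$. The circumference of a graph that contains a cycle is the length of its longest cycle, and $tL$ denotes the disjoint union of $t$ copies of $L$. Theorem 4. Let $F$ be a connected graph that contains a cycle, with constant link $L$ and circumference $c$. Then, for all integers $t \ge 2$ and $g > c$, there exists a connected graph with constant link $tL$ that has no cycle (as a not necessarily induced subgraph) of any length $l$ with $c < l < g$. -/

import Mathlib

namespace SimpleGraph

/-- The link of a vertex `v`: the subgraph of `G` induced by the open neighborhood of `v`. -/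
def link {V : Type*} (G : SimpleGraph V) (v : V) : SimpleGraph (G.neighborSet v) :=
  G.induce (G.neighborSet v)

/-- `G` has constant link `L` if the link of every vertex of `G` is isomorphic to `L`. -/
def HasConstantLink {V W : Type*} (G : SimpleGraph V) (L : SimpleGraph W) : Prop :=
  ∀ v : V, Nonempty (G.link v ≃g L)

/-- The disjoint union `tL` of `t` copies of the graph `L`; the copies are indexed by `Fin t`. -/
def copies {W : Type*} (t : ℕ) (L : SimpleGraph W) : SimpleGraph (Fin t × W) where
  Adj x y := x.1 = y.1 ∧ L.Adj x.2 y.2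
  symm := ⟨fun _ _ h => ⟨h.1.symm, h.2.symm⟩⟩
  loopless := ⟨fun _ h => h.2.ne rfl⟩

/-- `G` contains a cycle (as a subgraph, not necessarily induced) of length `l`. -/
def HasCycleOfLength {V : Type*} (G : SimpleGraph V) (l : ℕ) : Prop :=
  ∃ (v : V) (p : G.Walk v v), p.IsCycle ∧ p.length = l

/-- `G` has circumference `c`: it contains a cycle, and `c` is the length of a longest one. -/
def IsCircumference {V : Type*} (G : SimpleGraph V) (c : ℕ) : Prop :=
  IsGreatest {l : ℕ | G.HasCycleOfLength l} c

end SimpleGraph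

/-! Take a voltage cover, over a group `Γ`, of the Cartesian power of `F` with `t` factors: moving
from `u` to `v` in coordinate `i` multiplies the group entry on the right by `φ (i, u)⁻¹ * φ (i,
v)`. The vertices reached by moves in one direction form a block, a copy of `F`. Each vertex lies in
one block per direction and these blocks share no edges between them, so links are `t` copies of `L`
(`hasConstantLink_powerCover`). If the voltages were free generators, a walk changing blocks would
spell a reduced word that never cancels. A finite `Γ` in which short words stay nontrivial
(`exists_finite_quotient_norm`) suffices for short cycles: each lies in one block
(`exists_sameBlock_of_isCycle`), so its length is at most `c`. A connected component of the cover is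
the desired graph. -/

namespace FreeGroup

-- Free groups: residual finiteness and reduced words

universe u

variable {α : Type u}

/-- The closed ball of radius `N` around `1`, for the word length. -/
abbrev NormBall (α : Type u) [DecidableEq α] (N : ℕ) : Type u := {w : FreeGroup α // w.norm ≤ N}

theorem finite_normBall [DecidableEq α] [Finite α] (N : ℕ) : Finite (NormBall α N) := by
  have : Finite {l : List (α × Bool) // l.length ≤ N} :=
    (List.finite_length_le (α × Bool) N).to_subtype
  refine Finite.of_injective
    (fun w : NormBall α N => (⟨w.1.toWord, w.2⟩ : {l : List (α × Bool) // l.length ≤ N})) ?_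
  intro a b h
  exact Subtype.ext (toWord_injective (congrArg Subtype.val h))

/-- Left multiplication by a generator, where it stays in the ball, extends to a permutation of the
ball. -/
theorem exists_perm_normBall [DecidableEq α] [Finite α] (N : ℕ) (x : α) :
    ∃ σ : Equiv.Perm (NormBall α N), ∀ (w : FreeGroup α) (h : w.norm ≤ N)
      (h' : (of x * w).norm ≤ N), σ ⟨w, h⟩ = ⟨of x * w, h'⟩ := by
  have := finite_normBall (α := α) N
  obtain ⟨σ, hσ⟩ := Equiv.Perm.exists_extending_pair
    (α := {w : NormBall α N // (of x * w.1).norm ≤ N}) (β := NormBall α N)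
    (fun w => w.1) (fun w => ⟨of x * w.1.1, w.2⟩) Subtype.val_injective (by
      intro a b h
      have := congrArg Subtype.val h
      exact Subtype.ext (Subtype.ext (mul_left_cancel this)))
  exact ⟨σ, fun w h h' => hσ ⟨⟨w, h⟩, h'⟩⟩

/-- A quantitative form of the residual finiteness of free groups. -/
theorem exists_finite_quotient_norm [Finite α] [DecidableEq α] (N : ℕ) :
    ∃ (Γ : Type u) (_ : Group Γ) (_ : Finite Γ) (f : FreeGroup α →* Γ),
      ∀ w : FreeGroup α, w.norm ≤ N → f w = 1 → w = 1 := by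
  have := finite_normBall (α := α) N
  choose σ hσ using exists_perm_normBall (α := α) N
  refine ⟨Equiv.Perm (NormBall α N), inferInstance, inferInstance, lift σ, ?_⟩
  have hone : norm (1 : FreeGroup α) ≤ N := by rw [norm_one]; exact Nat.zero_le N
  -- Applied letter by letter from the right, the word moves `1` through its own suffixes, which all
  -- lie in the ball.
  have key : ∀ (L : List (α × Bool)), L.length ≤ N → ∀ h : (mk L).norm ≤ N,
      lift σ (mk L) ⟨1, hone⟩ = ⟨mk L, h⟩ := by
    intro L
    induction L with
    | nil => intro _ _; rfl
    | cons a L ih =>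
      intro hL hN
      have hL' : L.length ≤ N := by simp at hL; omega
      have hN' : (mk L).norm ≤ N := norm_mk_le.trans hL'
      obtain ⟨x, b⟩ := a
      cases b with
      | true =>
        have e : mk ((x, true) :: L) = of x * mk L := rfl
        have e' : lift σ (mk ((x, true) :: L)) = σ x * lift σ (mk L) := by
          rw [e, _root_.map_mul, lift_apply_of]
        rw [e', Equiv.Perm.mul_apply, ih hL' hN']
        exact hσ x _ hN' hN
      | false =>
        have e : mk ((x, false) :: L) = (of x)⁻¹ * mk L := rfl
        have e' : lift σ (mk ((x, false) :: L)) = (σ x)⁻¹ * lift σ (mk L) := by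
          rw [e, _root_.map_mul, _root_.map_inv, lift_apply_of]
        have h := mul_inv_cancel_left (of x) (mk L)
        rw [e', Equiv.Perm.mul_apply, ih hL' hN', Equiv.Perm.inv_eq_iff_eq,
          hσ x _ hN (by rw [e, h]; exact hN')]
        exact Subtype.ext h.symm
  intro w hw h1
  have h := key w.toWord hw (by rwa [mk_toWord])
  have h1' : lift σ (mk w.toWord) = 1 := by rw [mk_toWord, h1]
  rw [h1'] at h
  exact mk_toWord.symm.trans (congrArg Subtype.val h).symm

theorem eq_of_map_eq_of_norm_add_le [DecidableEq α] {Γ : Type*} [Group Γ] {f : FreeGroup α →* Γ}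
    {N : ℕ} (hf : ∀ w : FreeGroup α, w.norm ≤ N → f w = 1 → w = 1) {a b : FreeGroup α}
    (hN : a.norm + b.norm ≤ N) (h : f a = f b) : a = b := by
  refine mul_inv_eq_one.mp (hf _ ?_ (by simp [h]))
  exact (norm_mul_le _ _).trans (by simpa using hN)

theorem norm_mul_inv_of_mul_of_le [DecidableEq α] (w : FreeGroup α) (x y : α) :
    (w * (of x)⁻¹ * of y).norm ≤ w.norm + 2 := by
  have h1 := norm_mul_le (w * (of x)⁻¹) (of y)
  have h2 := norm_mul_le w (of x)⁻¹
  simp only [norm_inv_eq, norm_of] at h1 h2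
  omega

/-- Crossing a block appends two letters. Cancellation could occur only between them or where they
meet `w`, and the two hypotheses exclude both. -/
theorem toWord_mul_inv_of_mul_of [DecidableEq α] {w : FreeGroup α} {x y : α} (hxy : x ≠ y)
    (hw : (x, true) ∉ w.toWord.getLast?) :
    (w * (of x)⁻¹ * of y).toWord = w.toWord ++ [(x, false), (y, true)] := by
  have e : w * (of x)⁻¹ * of y = mk (w.toWord ++ [(x, false), (y, true)]) := by
    conv_lhs => rw [← mk_toWord (x := w)]
    simp [of, inv_mk, invRev, mul_mk]
  rw [e, toWord_mk]
  refine IsReduced.reduce_eq ?_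
  unfold IsReduced
  rw [List.isChain_append]
  refine ⟨isReduced_toWord, by simp [hxy], ?_⟩
  rintro ⟨z, b⟩ hz c hc
  simp only [List.head?_cons, Option.mem_def, Option.some.injEq] at hc
  subst hc
  rintro rfl
  cases b with
  | true => exact absurd hz hw
  | false => rfl

end FreeGroup

namespace SimpleGraph

/-! ### Transport along embeddings; connected components -/

section Transport

variable {U V W : Type*} {G : SimpleGraph U} {H : SimpleGraph V}

theorem HasCycleOfLength.map {l : ℕ} (h : G.HasCycleOfLength l) (f : G →g H)
    (hf : Function.Injective f) : H.HasCycleOfLength l := by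
  obtain ⟨v, p, hp, rfl⟩ := h
  exact ⟨f v, p.map f, hp.map hf, p.length_map f⟩

/-- An induced embedding whose range is closed under adjacency is an isomorphism on links. -/
noncomputable def linkIsoOfEmbedding (e : G ↪g H) (he : ∀ u v, H.Adj (e u) v → v ∈ Set.range e)
    (u : U) : G.link u ≃g H.link (e u) where
  toEquiv := Equiv.ofBijective
    (fun v => (⟨e v.1, e.map_adj_iff.mpr v.2⟩ : H.neighborSet (e u))) (by
      refine ⟨fun a b h => Subtype.ext (e.injective (congrArg Subtype.val h)), ?_⟩
      rintro ⟨v, hv⟩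
      obtain ⟨w, rfl⟩ := he u v hv
      exact ⟨⟨w, e.map_adj_iff.mp hv⟩, rfl⟩)
  map_rel_iff' := e.map_adj_iff

theorem HasConstantLink.of_embedding {L : SimpleGraph W} (h : H.HasConstantLink L) (e : G ↪g H)
    (he : ∀ u v, H.Adj (e u) v → v ∈ Set.range e) : G.HasConstantLink L := fun u =>
  ⟨(linkIsoOfEmbedding e he u).trans (h (e u)).some⟩

/-- A connected component of a finite graph, as a graph on a type in the lowest universe. -/
theorem exists_connected_embedding [Finite V] [Nonempty V] (H : SimpleGraph V) :
    ∃ (X : Type) (_ : Finite X) (G : SimpleGraph X) (e : G ↪g H),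
      G.Connected ∧ ∀ u v, H.Adj (e u) v → v ∈ Set.range e := by
  let C := H.connectedComponentMk (Classical.arbitrary V)
  obtain ⟨n, ⟨φ⟩⟩ := Finite.exists_equiv_fin C.supp
  let i : Fin n ↪ V := φ.symm.toEmbedding.trans (Function.Embedding.subtype _)
  refine ⟨Fin n, inferInstance, H.comap i, Embedding.comap i H, ?_, ?_⟩
  · let ψ : H.comap i ≃g C.toSimpleGraph := ⟨φ.symm, Iff.rfl⟩
    exact ψ.connected_iff.mpr C.connected_toSimpleGraph
  · intro u v huv
    have hu : (φ.symm u : V) ∈ C.supp := (φ.symm u).2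
    have hv : v ∈ C.supp := C.mem_supp_of_adj_mem_supp hu huv
    exact ⟨φ ⟨v, hv⟩, by simp [i]⟩

end Transport

/-! ### The cover of the Cartesian power and its links -/

section Cover

variable {ι V Γ : Type*} [Group Γ] (φ : ι × V → Γ)

/-- Two vertices of `Γ × (ι → V)` lie in the same block in direction `i`. -/
def SameBlock (i : ι) (x y : Γ × (ι → V)) : Prop :=
  (∀ j, j ≠ i → x.2 j = y.2 j) ∧ x.1 * (φ (i, x.2 i))⁻¹ = y.1 * (φ (i, y.2 i))⁻¹

variable {φ}

theorem SameBlock.refl (i : ι) (x : Γ × (ι → V)) : SameBlock φ i x x := ⟨fun _ _ => rfl, rfl⟩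

theorem SameBlock.symm {i : ι} {x y : Γ × (ι → V)} (h : SameBlock φ i x y) : SameBlock φ i y x :=
  ⟨fun j hj => (h.1 j hj).symm, h.2.symm⟩

theorem SameBlock.trans {i : ι} {x y z : Γ × (ι → V)} (h : SameBlock φ i x y)
    (h' : SameBlock φ i y z) : SameBlock φ i x z :=
  ⟨fun j hj => (h.1 j hj).trans (h'.1 j hj), h.2.trans h'.2⟩

theorem SameBlock.fst_eq {i : ι} {x y : Γ × (ι → V)} (h : SameBlock φ i x y) :
    y.1 = x.1 * (φ (i, x.2 i))⁻¹ * φ (i, y.2 i) := by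
  rw [h.2]; group

/-- Coordinate `i` is injective on a block in direction `i`, so the block embeds in `F`. -/
theorem SameBlock.eq {i : ι} {x y : Γ × (ι → V)} (h : SameBlock φ i x y) (hi : x.2 i = y.2 i) :
    x = y := by
  refine Prod.ext ?_ (funext fun j => ?_)
  · have := h.2
    rw [hi] at this
    exact mul_right_cancel this
  · by_cases hj : j = i
    · rw [hj, hi]
    · exact h.1 j hj

variable (φ) in
/-- The cover with voltages `φ` of the Cartesian power `F ^ ι`. -/
def powerCover (F : SimpleGraph V) : SimpleGraph (Γ × (ι → V)) where
  Adj x y := ∃ i, SameBlock φ i x y ∧ F.Adj (x.2 i) (y.2 i)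
  symm := ⟨fun _ _ ⟨i, h, h'⟩ => ⟨i, h.symm, h'.symm⟩⟩
  loopless := ⟨fun _ ⟨_, _, h⟩ => h.ne rfl⟩

variable {F : SimpleGraph V}

theorem SameBlock.powerCover_adj_iff {i : ι} {x y : Γ × (ι → V)} (h : SameBlock φ i x y) :
    (powerCover φ F).Adj x y ↔ F.Adj (x.2 i) (y.2 i) := by
  refine ⟨?_, fun h' => ⟨i, h, h'⟩⟩
  rintro ⟨k, -, hk⟩
  by_cases hki : k = i
  · exact hki ▸ hk
  · exact absurd (h.1 k hki) hk.ne

/-- The vertex in the block of `x` in direction `i` whose `i`-th coordinate is `u`. -/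
def blockMove [DecidableEq ι] (φ : ι × V → Γ) (x : Γ × (ι → V)) (i : ι) (u : V) :
    Γ × (ι → V) :=
  (x.1 * (φ (i, x.2 i))⁻¹ * φ (i, u), Function.update x.2 i u)

theorem sameBlock_blockMove [DecidableEq ι] (x : Γ × (ι → V)) (i : ι) (u : V) :
    SameBlock φ i x (blockMove φ x i u) :=
  ⟨fun j hj => by simp [blockMove, hj], by simp [blockMove]⟩

theorem blockMove_snd_self [DecidableEq ι] (x : Γ × (ι → V)) (i : ι) (u : V) :
    (blockMove φ x i u).2 i = u := by simp [blockMove]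

theorem blockMove_snd_of_ne [DecidableEq ι] (x : Γ × (ι → V)) {i j : ι} (h : j ≠ i) (u : V) :
    (blockMove φ x i u).2 j = x.2 j := by simp [blockMove, h]

theorem powerCover_adj_blockMove [DecidableEq ι] {x : Γ × (ι → V)} {i : ι} {u : V}
    (h : F.Adj (x.2 i) u) : (powerCover φ F).Adj x (blockMove φ x i u) :=
  ⟨i, sameBlock_blockMove x i u, by rwa [blockMove_snd_self]⟩

theorem powerCover_blockMove_adj_iff [DecidableEq ι] {x : Γ × (ι → V)} {i j : ι} {u v : V}
    (hu : F.Adj (x.2 i) u) (hv : F.Adj (x.2 j) v) :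
    (powerCover φ F).Adj (blockMove φ x i u) (blockMove φ x j v) ↔ i = j ∧ F.Adj u v := by
  by_cases hij : i = j
  · subst hij
    rw [((sameBlock_blockMove x i u).symm.trans (sameBlock_blockMove x i v)).powerCover_adj_iff]
    simp [blockMove_snd_self]
  -- Moves of `x` in distinct directions give vertices differing in two coordinates, whereas an edge
  -- changes only one.
  · simp only [hij, false_and, iff_false]
    rintro ⟨k, hk, -⟩
    by_cases hki : k = i
    · have := hk.1 j (fun h => hij (hki.symm.trans h.symm))
      rw [blockMove_snd_self, blockMove_snd_of_ne x (Ne.symm hij)] at this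
      exact hv.ne this
    · have := hk.1 i (Ne.symm hki)
      rw [blockMove_snd_self, blockMove_snd_of_ne x hij] at this
      exact hu.ne this.symm

theorem bijective_blockMove [DecidableEq ι] (x : Γ × (ι → V)) :
    Function.Bijective (fun a : Σ i, F.neighborSet (x.2 i) =>
      (⟨blockMove φ x a.1 a.2.1, powerCover_adj_blockMove a.2.2⟩ :
        (powerCover φ F).neighborSet x)) := by
  constructor
  · rintro ⟨i, u, hu⟩ ⟨j, v, hv⟩ h
    have h : blockMove φ x i u = blockMove φ x j v := congrArg Subtype.val h
    have hi := congrFun (congrArg Prod.snd h) i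
    rw [blockMove_snd_self] at hi
    by_cases hij : i = j
    · subst hij
      rw [blockMove_snd_self] at hi
      subst hi
      rfl
    · rw [blockMove_snd_of_ne x hij] at hi
      exact absurd hi.symm hu.ne
  · rintro ⟨y, i, hy, hF⟩
    refine ⟨⟨i, y.2 i, hF⟩, Subtype.ext ?_⟩
    exact ((sameBlock_blockMove x i (y.2 i)).symm.trans hy).eq (blockMove_snd_self x i _)

theorem hasConstantLink_powerCover {W : Type*} {L : SimpleGraph W} {t : ℕ}
    (φ : Fin t × V → Γ) (hL : F.HasConstantLink L) :
    (powerCover φ F).HasConstantLink (copies t L) := by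
  intro x
  let e : (Σ i, F.neighborSet (x.2 i)) ≃ (powerCover φ F).neighborSet x :=
    Equiv.ofBijective _ (bijective_blockMove x)
  let ψ : (i : Fin t) → F.link (x.2 i) ≃g L := fun i => (hL (x.2 i)).some
  let e' : (Σ i, F.neighborSet (x.2 i)) ≃ Fin t × W :=
    (Equiv.sigmaCongrRight fun i => (ψ i).toEquiv).trans (Equiv.sigmaEquivProd _ _)
  refine ⟨⟨e.symm.trans e', ?_⟩⟩
  intro a b
  obtain ⟨⟨i, u, hu⟩, rfl⟩ := e.surjective a
  obtain ⟨⟨j, v, hv⟩, rfl⟩ := e.surjective b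
  simp only [Equiv.trans_apply, Equiv.symm_apply_apply]
  refine Iff.trans ?_ (powerCover_blockMove_adj_iff (φ := φ) hu hv).symm
  refine and_congr_right fun hij => ?_
  change i = j at hij
  subst hij
  exact (ψ i).map_adj_iff

end Cover

/-! ### Short cycles lie in blocks -/

section ShortCycles

variable {ι V Γ : Type*} [Group Γ] [DecidableEq ι] [DecidableEq V] {F : SimpleGraph V}

/-- A nontrivial path from `a` to `b` enters the block in which its edge at `a` lies at a vertex
`s` whose position relative to `b` is a word that cannot cancel against that block; if this word is
trivial, the path stays in one block. -/
theorem exists_word_of_isPath (f : FreeGroup (ι × V) →* Γ) {a b : Γ × (ι → V)}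
    (p : (powerCover (fun x => f (.of x)) F).Walk a b) (hp : p.IsPath) (hab : a ≠ b) :
    ∃ (i : ι) (s : Γ × (ι → V)) (w : FreeGroup (ι × V)), s ∈ p.support ∧ s ≠ a ∧
      SameBlock (fun x => f (.of x)) i s a ∧ s.1 = b.1 * f w ∧ w.norm ≤ 2 * p.length ∧
      (∀ u, ((i, u), true) ∉ w.toWord.getLast?) ∧
      (w = 1 → ∀ x ∈ p.support, SameBlock (fun x => f (.of x)) i b x) := by
  induction p with
  | nil => exact absurd rfl hab
  | @cons a a' b h p ih =>
    rw [Walk.cons_isPath_iff] at hp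
    obtain ⟨j, hj, hF⟩ := id h
    by_cases hb : a' = b
    · subst hb
      obtain rfl := (Walk.isPath_iff_nil.mp hp.1).eq_nil
      refine ⟨j, a', 1, by simp, hab.symm, hj.symm, by simp, by simp, by simp, fun _ x hx => ?_⟩
      simp only [Walk.support_cons, Walk.support_nil, List.mem_cons, List.not_mem_nil,
        or_false] at hx
      rcases hx with rfl | rfl
      · exact hj.symm
      · exact SameBlock.refl _ _
    · obtain ⟨i, s, w, hs, hsa, hblock, hw, hlen, hlast, hone⟩ := ih hp.1 hb
      by_cases hij : j = i
      · subst hij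
        refine ⟨j, s, w, by simp [hs], fun e => hp.2 (e ▸ hs), hblock.trans hj.symm, hw, ?_, hlast,
          fun h1 x hx => ?_⟩
        · rw [Walk.length_cons]; omega
        · rw [Walk.support_cons, List.mem_cons] at hx
          rcases hx with rfl | hx
          · exact (hone h1 _ p.start_mem_support).trans hj.symm
          · exact hone h1 x hx
      -- The direction changes at `a'`, so the crossing from `s` to `a'` is recorded. The word now
      -- ends in a letter of direction `i ≠ j`, which cannot cancel against a block in direction
      -- `j`.
      · have hne : ((i, s.2 i) : ι × V) ≠ (i, a'.2 i) := fun e =>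
          hsa (hblock.eq (Prod.mk.inj e).2)
        have hword := FreeGroup.toWord_mul_inv_of_mul_of hne (hlast _)
        refine ⟨j, a', w * (.of (i, s.2 i))⁻¹ * .of (i, a'.2 i), by simp, ?_, hj.symm, ?_, ?_, ?_,
          ?_⟩
        · rintro rfl
          exact hF.ne rfl
        · rw [hblock.fst_eq, hw]
          simp [mul_assoc]
        · have := FreeGroup.norm_mul_inv_of_mul_of_le w (i, s.2 i) (i, a'.2 i)
          rw [Walk.length_cons]
          omega
        · intro u
          rw [hword]
          simp [Ne.symm hij]
        · intro h1
          rw [h1] at hword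
          simp at hword

/-- If `f` is injective on short words, a short cycle of the cover lies in a single block. -/
theorem exists_sameBlock_of_isCycle (f : FreeGroup (ι × V) →* Γ) {N : ℕ}
    (hf : ∀ w : FreeGroup (ι × V), w.norm ≤ N → f w = 1 → w = 1) {a : Γ × (ι → V)}
    (p : (powerCover (fun x => f (.of x)) F).Walk a a) (hp : p.IsCycle)
    (hN : 2 * p.length + 2 ≤ N) :
    ∃ i, ∀ x ∈ p.support, SameBlock (fun x => f (.of x)) i a x := by
  cases p with
  | nil => exact absurd rfl hp.ne_nil
  | @cons _ b _ h p =>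
    rw [Walk.cons_isCycle_iff] at hp
    obtain ⟨i, s, w, -, hsa, hblock, hw, hlen, hlast, hone⟩ :=
      exists_word_of_isPath f p hp.1 h.ne'
    obtain ⟨j, hj, hF⟩ := id h
    have hne : ((i, s.2 i) : ι × V) ≠ (i, b.2 i) := fun e => hsa (hblock.eq (Prod.mk.inj e).2)
    have hne' : ((j, a.2 j) : ι × V) ≠ (j, b.2 j) := fun e => hF.ne (Prod.mk.inj e).2
    -- Both sides carry `a.1` to `b.1`: the left one back along the path through `s`, the right one
    -- along the closing edge.
    have hmap : f (w * (.of (i, s.2 i))⁻¹ * .of (i, b.2 i)) =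
        f (1 * (.of (j, a.2 j))⁻¹ * .of (j, b.2 j)) := by
      have h1 := hblock.fst_eq
      rw [hj.fst_eq, hw] at h1
      simpa [mul_assoc] using h1.symm
    have heq := FreeGroup.eq_of_map_eq_of_norm_add_le hf (by
      have h1 := FreeGroup.norm_mul_inv_of_mul_of_le w (i, s.2 i) (i, b.2 i)
      have h2 := FreeGroup.norm_mul_inv_of_mul_of_le 1 (j, a.2 j) (j, b.2 j)
      rw [FreeGroup.norm_one] at h2
      rw [Walk.length_cons] at hN
      omega) hmap
    have hword := congrArg FreeGroup.toWord heq
    rw [FreeGroup.toWord_mul_inv_of_mul_of hne (hlast _),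
      FreeGroup.toWord_mul_inv_of_mul_of hne' (by simp)] at hword
    -- Both reduced words end in two appended letters, and on the right nothing precedes them.
    have hnil : w.toWord = [] := by
      have := congrArg List.length hword
      simpa using this
    refine ⟨i, fun x hx => ?_⟩
    rw [Walk.support_cons, List.mem_cons] at hx
    rcases hx with rfl | hx
    · exact SameBlock.refl _ _
    · exact hone (FreeGroup.toWord_eq_nil_iff.mp hnil) x hx

/-- If `f` is injective on short words, the lengths of short cycles of the cover are lengths of
cycles of `F`. -/
theorem HasCycleOfLength.of_powerCover (f : FreeGroup (ι × V) →* Γ) {N l : ℕ}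
    (hf : ∀ w : FreeGroup (ι × V), w.norm ≤ N → f w = 1 → w = 1) (hN : 2 * l + 2 ≤ N)
    (h : (powerCover (fun x => f (.of x)) F).HasCycleOfLength l) : F.HasCycleOfLength l := by
  obtain ⟨a, p, hp, rfl⟩ := h
  obtain ⟨i, hi⟩ := exists_sameBlock_of_isCycle f hf p hp hN
  let S : Set (Γ × (ι → V)) := {x | SameBlock (fun x => f (.of x)) i a x}
  have hS : ∀ x ∈ p.support, x ∈ S := hi
  have hblock : ∀ x y : S, SameBlock (fun x => f (.of x)) i x.1 y.1 := fun x y =>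
    SameBlock.trans (SameBlock.symm x.2) y.2
  let π : (powerCover (fun x => f (.of x)) F).induce S →g F :=
    ⟨fun x => x.1.2 i, fun {x y} hxy => (hblock x y).powerCover_adj_iff.mp hxy⟩
  have hπ : Function.Injective π := fun x y hxy => Subtype.ext ((hblock x y).eq hxy)
  refine HasCycleOfLength.map ⟨_, p.induce S hS, ?_, ?_⟩ π hπ
  · refine Walk.IsCycle.of_map (f := (Embedding.induce S).toHom) ?_
    rwa [Walk.map_induce]
  · rw [← Walk.length_map (Embedding.induce S).toHom, Walk.map_induce]
    rfl

end ShortCycles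

end SimpleGraph

theorem theorem4 {V W : Type*} [Finite V] (F : SimpleGraph V) (L : SimpleGraph W) (c : ℕ)
    (hF : F.Connected) (hL : F.HasConstantLink L) (hc : F.IsCircumference c)
    (t g : ℕ) (ht : 2 ≤ t) (hg : c < g) :
    ∃ (X : Type) (_ : Finite X) (G : SimpleGraph X),
      G.Connected ∧ G.HasConstantLink (SimpleGraph.copies t L) ∧
        ∀ l : ℕ, c < l → l < g → ¬ G.HasCycleOfLength l := by
  classical
  -- For a cycle of length `l`, the two compared words have norms at most `2 * (l - 1) + 2` and `2`,
  -- in total `2 * l + 2`.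
  obtain ⟨Γ, _, _, f, hf⟩ :=
    FreeGroup.exists_finite_quotient_norm (α := Fin t × V) (2 * g + 2)
  have := hF.nonempty
  obtain ⟨X, hX, G, e, hG, he⟩ :=
    SimpleGraph.exists_connected_embedding (SimpleGraph.powerCover (fun x => f (.of x)) F)
  refine ⟨X, hX, G, hG, (SimpleGraph.hasConstantLink_powerCover _ hL).of_embedding e he, fun l hcl hlg hl => ?_⟩
  have hl' := (hl.map e.toHom e.injective).of_powerCover f hf (by omega)
  exact absurd (hc.2 hl') (by omega)
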